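/- Let $k$ be a field. A *curve* over $k$ is a smooth, separated, geometrically integral $k$-scheme of finite type and of dimension $1$; a *morphism of curves* is a non-constant, finite, generically separable morphism of $k$-schemes. Let $X \xleftarrow{f} Z \xrightarrow{g} Y$ be a correspondence of curves over $k$ (i.e. $f$, $g$ are morphisms of curves) that is *minimal*: the induced map $Z \to X\times_k Y$ is birational onto its image. Regard $k(X)$ and $k(Y)$ as subfields of $k(Z)$ via $f^*$ and $g^*$. Let $\Omega$ be an algebraically closed extension of $k$ and fix a $k$-algebra embedding $PQ : k(Z)\hookrightarrow\Omega$ that makes $\Omega$ an algebraic closure of $k(Z)$. Put $P = PQ|_{k(X)}$ and $Q = PQ|_{k(Y)}$. The full generic graph has as blue vertices the $k$-algebra embeddings $k(X)\hookrightarrow\Omega$ and as red vertices the $k$-algebra embeddings $k(Y)\hookrightarrow\Omega$; a blue vertex $p$ and a red vertex $q$ are joined by an edge if and only if there is a $k$-algebra embedding $k(Z)\hookrightarrow\Omega$ that restricts to $p$ and to $q$. Let $\mathcal G_{gen}$ be the connected component that contains $P$ (and hence $Q$). Let $E_\infty\subset\Omega$ be the union of the tower $E_0\subset E_1\subset\cdots$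 of subfields of $\Omega$, where $E_0 = PQ(k(Z))$ and $E_{n+1}$ is the Galois closure of $E_n$ in $\Omega$ over $Q(k(Y))$ for $n$ even and over $P(k(X))$ for $n$ odd. Give $\mathrm{Aut}_k(E_\infty)$ the topology in which the pointwise stabilizers of finite subsets of $E_\infty$ form a neighbourhood base of the identity. Let $$G_P = \mathrm{Gal}(E_\infty/P(k(X))),\quad G_Q = \mathrm{Gal}(E_\infty/Q(k(Y))),\quad G_{PQ} = \mathrm{Gal}(E_\infty/PQ(k(Z))) \subset G_P\cap G_Q,$$ and let $A^{PQ}$ be the subgroup of $\mathrm{Aut}_k(E_\infty)$ generated by $G_P$ and $G_Q$; all these groups carry the subspace topology. The amalgamated product $G_P *_{G_{PQ}} G_Q$ carries the topology generated by those of $G_P$ and $G_Q$, i.e. the finest group topology for which the canonical maps from $G_P$ and from $G_Q$ are continuous. **Proposition.** If $\mathcal G_{gen}$ is a tree, then the natural map $G_P *_{G_{PQ}} G_Q \to A^{PQ}$ induced by the inclusions of $G_P$ and $G_Q$ is an isomorphism of topological groups. -/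

import Mathlib

universe u v

open CategoryTheory CategoryTheory.Limits AlgebraicGeometry

noncomputable section

/-! ### Curves, their function fields, and correspondences -/

/-- A smooth curve over a field `k`: a geometrically integral, smooth, separated scheme of finite
type over `k`, of dimension one. (Smoothness contains local finite presentation.) -/
structure Curve (k : Type u) [Field k] where
  /-- the underlying scheme -/
  scheme : Scheme.{u}
  /-- the structure morphism -/
  str : scheme ⟶ Spec (CommRingCat.of k)
  geometricallyIntegral : GeometricallyIntegral str
  smooth : Smooth str
  separated : IsSeparated str
  quasiCompact : QuasiCompact str
  dim_eq_one : topologicalKrullDim scheme = 1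

/-- The pull-back homomorphism on function fields of a dominant morphism of integral schemes: the
stalk map at the generic point of `Z`, composed with the (invertible) specialization map that
identifies the stalks of `X` at `genericPoint X` and at `f (genericPoint Z)`, which are the same
point. -/
def functionFieldMap {Z X : Scheme.{u}} [IsIntegral Z] [IsIntegral X] (f : Z ⟶ X) [IsDominant f] :
    X.functionField ⟶ Z.functionField :=
  X.presheaf.stalkSpecializes
      (((genericPoint_spec Z).image f.continuous).specializes (by
        rw [Set.image_univ, f.denseRange.closure_range]; trivial)) ≫
    f.stalkMap (genericPoint Z)

namespace Curve

variable {k : Type u} [Field k]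

instance (C : Curve k) : IsIntegral C.scheme :=
  haveI := C.geometricallyIntegral
  GeometricallyIntegral.isIntegral_of_subsingleton C.str

/-- The function field `k(C)` of a curve. -/
def FunctionField (C : Curve k) : Type u := C.scheme.functionField

instance (C : Curve k) : Field C.FunctionField :=
  inferInstanceAs (Field C.scheme.functionField)

/-- The constants `k → Γ(C, ⊤) → k(C)`. -/
def constants (C : Curve k) : CommRingCat.of k ⟶ C.scheme.functionField :=
  (Scheme.ΓSpecIso (CommRingCat.of k)).inv ≫ C.str.appTop ≫ C.scheme.presheaf.germ ⊤ (genericPoint C.scheme) (TopologicalSpace.Opens.mem_top _)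

instance (C : Curve k) : Algebra k C.FunctionField :=
  RingHom.toAlgebra (S := C.FunctionField) C.constants.hom

end Curve

/-- A morphism of curves over `k`: a morphism of `k`-schemes that is non-constant (for curves:
dominant), finite and generically separable, i.e. the induced extension of function fields is
separable. -/
structure CurveHom {k : Type u} [Field k] (Z X : Curve k) where
  /-- the underlying morphism of schemes -/
  hom : Z.scheme ⟶ X.scheme
  comp_str : hom ≫ X.str = Z.str
  finite : IsFinite hom
  dominant : IsDominant hom
  separable : @Algebra.IsSeparable X.FunctionField Z.FunctionField _ _
    (functionFieldMap hom).hom.toAlgebra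

namespace CurveHom

variable {k : Type u} [Field k] {Z X : Curve k}

theorem constants_comp (f : CurveHom Z X) :
    X.constants ≫ (haveI := f.dominant; functionFieldMap f.hom) = Z.constants := by
  have := f.dominant
  have h : Z.str.appTop = X.str.appTop ≫ f.hom.appTop := by
    rw [← f.comp_str]; rfl
  simp only [Curve.constants, functionFieldMap, Category.assoc, h]
  congr 2
  rw [TopCat.Presheaf.germ_stalkSpecializes_assoc (hy := TopologicalSpace.Opens.mem_top _)]
  exact Scheme.Hom.germ_stalkMap f.hom ⊤ _ (TopologicalSpace.Opens.mem_top _)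

/-- The embedding of function fields `f^* : k(X) → k(Z)`. -/
def pullback (f : CurveHom Z X) : X.FunctionField →ₐ[k] Z.FunctionField where
  toRingHom := haveI := f.dominant; (functionFieldMap f.hom).hom
  commutes' r := ConcreteCategory.congr_hom f.constants_comp r

end CurveHom

/-- A correspondence of curves `X ← Z → Y` over `k`. -/
structure Correspondence (k : Type u) [Field k] where
  X : Curve k
  Y : Curve k
  Z : Curve k
  f : CurveHom Z X
  g : CurveHom Z Y

/-- A morphism of schemes `φ : Z ⟶ W` is birational onto its (scheme-theoretic) image if the
induced morphism `Z ⟶ φ.image` restricts to an isomorphism between dense open subschemes. -/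
def IsBirationalOntoImage {Z W : Scheme.{u}} (φ : Z ⟶ W) : Prop :=
  ∃ e : Z.PartialIso φ.image, e.iso.hom ≫ e.target.ι = e.source.ι ≫ φ.toImage

/-- A correspondence is minimal if `Z ⟶ X ×ₖ Y` is birational onto its image. -/
def Correspondence.IsMinimal {k : Type u} [Field k] (C : Correspondence k) : Prop :=
  IsBirationalOntoImage
    (pullback.lift (f := C.X.str) (g := C.Y.str) C.f.hom C.g.hom (C.f.comp_str.trans C.g.comp_str.symm))

/-! ### The topological automorphism group of a field extension -/

/-- The group `Aut_k(E)` of `k`-algebra automorphisms of a field `E`. It is a copy of `E ≃ₐ[k] E`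
because Mathlib's Krull topology on the latter is not the one wanted here when `E` is
transcendental over `k`. -/
def FieldAut (k : Type u) (E : Type v) [Field k] [Field E] [Algebra k E] : Type v := E ≃ₐ[k] E

namespace FieldAut

variable {k : Type u} {E : Type v} [Field k] [Field E] [Algebra k E]

instance : Group (FieldAut k E) := inferInstanceAs (Group (E ≃ₐ[k] E))

instance : EquivLike (FieldAut k E) E E := inferInstanceAs (EquivLike (E ≃ₐ[k] E) E E)

instance : AlgEquivClass (FieldAut k E) k E E :=
  inferInstanceAs (AlgEquivClass (E ≃ₐ[k] E) k E E)

theorem mul_apply (g h : FieldAut k E) (x : E) : (g * h) x = g (h x) := rfl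

theorem one_apply (x : E) : (1 : FieldAut k E) x = x := rfl

theorem inv_apply_self (g : FieldAut k E) (x : E) : g⁻¹ (g x) = x :=
  AlgEquiv.symm_apply_apply (g : E ≃ₐ[k] E) x

theorem apply_inv_self (g : FieldAut k E) (x : E) : g (g⁻¹ x) = x :=
  AlgEquiv.apply_symm_apply (g : E ≃ₐ[k] E) x

/-- The compact-open topology for discrete `E`, i.e. the topology of pointwise convergence. A
neighbourhood base of `1` is given by the pointwise stabilizers of the finite subsets of `E`. -/
instance : TopologicalSpace (FieldAut k E) :=
  TopologicalSpace.induced (fun g (x : E) => g x) (@Pi.topologicalSpace E (fun _ => E) fun _ => ⊥)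

theorem isOpen_setOf_apply_eq (x y : E) : IsOpen {g : FieldAut k E | g x = y} := by
  let _ : TopologicalSpace E := ⊥
  have : DiscreteTopology E := ⟨rfl⟩
  have h : Continuous fun g : FieldAut k E => g x :=
    (continuous_apply x).comp continuous_induced_dom
  exact (isOpen_discrete {y}).preimage h

theorem continuous_of_isOpen {T : Type*} [TopologicalSpace T] {φ : T → FieldAut k E}
    (h : ∀ x y, IsOpen {t | φ t x = y}) : Continuous φ := by
  let _ : TopologicalSpace E := ⊥
  have : DiscreteTopology E := ⟨rfl⟩
  refine continuous_induced_rng.2 (continuous_pi fun x => ?_)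
  exact continuous_discrete_rng.2 fun y => h x y

instance : IsTopologicalGroup (FieldAut k E) where
  continuous_mul := continuous_of_isOpen fun x y => by
    have : {p : FieldAut k E × FieldAut k E | (p.1 * p.2) x = y} =
        ⋃ z, {g | g z = y} ×ˢ {g | g x = z} := by
      ext p; simp [mul_apply]
    rw [this]
    exact isOpen_iUnion fun z => (isOpen_setOf_apply_eq z y).prod (isOpen_setOf_apply_eq x z)
  continuous_inv := continuous_of_isOpen fun x y => by
    have : {g : FieldAut k E | g⁻¹ x = y} = {g | g y = x} := by
      ext g
      constructor
      · rintro rfl; exact apply_inv_self g x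
      · rintro rfl; exact inv_apply_self g y
    rw [this]
    exact isOpen_setOf_apply_eq y x

end FieldAut

/-- For intermediate fields `F ≤ E` of `Ω / k`, the Galois group `Gal(E / F)`, as a subgroup of
`Aut_k(E)`. -/
def galoisSubgroup {k : Type u} {Ω : Type v} [Field k] [Field Ω] [Algebra k Ω]
    (E F : IntermediateField k Ω) : Subgroup (FieldAut k E) where
  carrier := {g | ∀ x : E, (x : Ω) ∈ F → g x = x}
  one_mem' _ _ := rfl
  mul_mem' {g h} hg hh x hx := by rw [FieldAut.mul_apply, hh x hx, hg x hx]
  inv_mem' {g} hg x hx := by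
    conv_lhs => rw [← hg x hx]
    exact FieldAut.inv_apply_self g x

theorem galoisSubgroup_anti {k : Type u} {Ω : Type v} [Field k] [Field Ω] [Algebra k Ω]
    (E : IntermediateField k Ω) {F F' : IntermediateField k Ω} (h : F ≤ F') :
    galoisSubgroup E F' ≤ galoisSubgroup E F :=
  fun _ hg x hx => hg x (h hx)

/-- The Galois (i.e. normal) closure inside `Ω` of the compositum `F E` over `F`; when `F ≤ E` is
separable, this is the Galois closure of `E / F` in `Ω`. -/
def galoisClosureIn {k : Type u} {Ω : Type v} [Field k] [Field Ω] [Algebra k Ω]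
    (F E : IntermediateField k Ω) : IntermediateField k Ω :=
  (IntermediateField.normalClosure F (IntermediateField.adjoin F (E : Set Ω)) Ω).restrictScalars k

/-! ### The generic graph and the groups acting on it

Throughout, `i : L → M` and `j : K → M` are the inclusions `k(X) → k(Z)` and `k(Y) → k(Z)` of
function fields, and `PQ : M → Ω` is the fixed embedding. -/

section GenericGraph

variable {k : Type u} {L K M : Type u} {Ω : Type v} [Field k] [Field L] [Field K] [Field M]
  [Field Ω] [Algebra k L] [Algebra k K] [Algebra k M] [Algebra k Ω]

/-- The full generic graph. Blue vertices (`Sum.inl`) are the `k`-embeddings `k(X) → Ω`, red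
vertices (`Sum.inr`) are the `k`-embeddings `k(Y) → Ω`; a blue `p` and a red `q` are adjacent if
there is a `k`-embedding `k(Z) → Ω` that restricts to `p` and to `q`. -/
def fullGenericGraph (Ω : Type v) [Field Ω] [Algebra k Ω] (i : L →ₐ[k] M) (j : K →ₐ[k] M) :
    SimpleGraph ((L →ₐ[k] Ω) ⊕ (K →ₐ[k] Ω)) where
  Adj
    | .inl p, .inr q => ∃ e : M →ₐ[k] Ω, e.comp i = p ∧ e.comp j = q
    | .inr q, .inl p => ∃ e : M →ₐ[k] Ω, e.comp i = p ∧ e.comp j = q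
    | _, _ => False
  symm := ⟨by rintro (p | q) (p' | q') h <;> exact h⟩
  loopless := ⟨by rintro (p | q) h <;> exact h⟩

variable (i : L →ₐ[k] M) (j : K →ₐ[k] M) (PQ : M →ₐ[k] Ω)

/-- The connected component of the full generic graph that contains the edge `PQ`. -/
def genericComponent : (fullGenericGraph Ω i j).ConnectedComponent :=
  (fullGenericGraph Ω i j).connectedComponentMk (Sum.inl (PQ.comp i))

/-- The generic graph. -/
def genericGraph : SimpleGraph (genericComponent i j PQ) :=
  (genericComponent i j PQ).toSimpleGraph

/-- The tower of iterated Galois closures inside `Ω`: start with `PQ(k(Z))` and take alternately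
the Galois closure over `Q(k(Y))` and over `P(k(X))`. -/
def galoisTower : ℕ → IntermediateField k Ω
  | 0 => PQ.fieldRange
  | n + 1 => galoisClosureIn (if Even n then (PQ.comp j).fieldRange else (PQ.comp i).fieldRange)
      (galoisTower n)

/-- The field `E_∞ ⊆ Ω`, the union of the tower. -/
def fieldInfty : IntermediateField k Ω := ⨆ n, galoisTower i j PQ n

/-- `G_P = Gal(E_∞ / P(k(X)))` (for `false`) and `G_Q = Gal(E_∞ / Q(k(Y)))` (for `true`). -/
def vertexGroup : Bool → Subgroup (FieldAut k (fieldInfty i j PQ))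
  | false => galoisSubgroup (fieldInfty i j PQ) (PQ.comp i).fieldRange
  | true => galoisSubgroup (fieldInfty i j PQ) (PQ.comp j).fieldRange

/-- `G_{PQ} = Gal(E_∞ / PQ(k(Z)))`. -/
def edgeGroup : Subgroup (FieldAut k (fieldInfty i j PQ)) :=
  galoisSubgroup (fieldInfty i j PQ) PQ.fieldRange

theorem edgeGroup_le (b : Bool) : edgeGroup i j PQ ≤ vertexGroup i j PQ b := by
  cases b
  · refine galoisSubgroup_anti _ ?_
    rintro _ ⟨x, rfl⟩
    exact ⟨i x, rfl⟩
  · refine galoisSubgroup_anti _ ?_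
    rintro _ ⟨x, rfl⟩
    exact ⟨j x, rfl⟩

/-- `A^{PQ}`, the subgroup of `Aut_k(E_∞)` generated by `G_P` and `G_Q`; as a type, it carries the
subspace topology. -/
def groupAPQ : Subgroup (FieldAut k (fieldInfty i j PQ)) :=
  vertexGroup i j PQ false ⊔ vertexGroup i j PQ true

theorem vertexGroup_le (b : Bool) : vertexGroup i j PQ b ≤ groupAPQ i j PQ := by
  cases b
  · exact le_sup_left
  · exact le_sup_right

/-- The amalgamated product `G_P *_{G_{PQ}} G_Q`. -/
def Amalgam : Type v :=
  Monoid.PushoutI fun b : Bool => Subgroup.inclusion (edgeGroup_le i j PQ b)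

namespace Amalgam

instance : Group (Amalgam i j PQ) :=
  inferInstanceAs (Group (Monoid.PushoutI fun b : Bool =>
    Subgroup.inclusion (edgeGroup_le i j PQ b)))

/-- The canonical maps from `G_P` and `G_Q` to the amalgamated product. -/
def of (b : Bool) : vertexGroup i j PQ b →* Amalgam i j PQ :=
  Monoid.PushoutI.of (φ := fun b : Bool => Subgroup.inclusion (edgeGroup_le i j PQ b)) b

/-- The topology on the amalgamated product generated by those of `G_P` and `G_Q`: the finest group
topology for which the canonical maps from `G_P` and `G_Q` are continuous. -/
def groupTopology : GroupTopology (Amalgam i j PQ) :=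
  sInf {t | ∀ b, @Continuous _ _ _ t.toTopologicalSpace (of i j PQ b)}

instance : TopologicalSpace (Amalgam i j PQ) := (groupTopology i j PQ).toTopologicalSpace

instance : IsTopologicalGroup (Amalgam i j PQ) := (groupTopology i j PQ).toIsTopologicalGroup

/-- The natural map `G_P *_{G_{PQ}} G_Q → A^{PQ}` induced by the inclusions of `G_P` and `G_Q`. -/
def toGroupAPQ : Amalgam i j PQ →* groupAPQ i j PQ :=
  Monoid.PushoutI.lift (φ := fun b : Bool => Subgroup.inclusion (edgeGroup_le i j PQ b))
    (fun b => Subgroup.inclusion (vertexGroup_le i j PQ b))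
    (Subgroup.inclusion ((edgeGroup_le i j PQ false).trans (vertexGroup_le i j PQ false)))
    (fun _ => rfl)

end Amalgam

end GenericGraph

end

/-! ### Function fields -/

/-! This is Bass–Serre theory made explicit by a ping-pong argument. Automorphisms of `E_∞` extend
to `Ω` and so act on the full generic graph; `G_P` fixes `P` and `G_Q` fixes `Q`. By minimality
`k(Z)` is generated by `k(X)` and `k(Y)`, so whatever fixes both ends of the edge `PQ` lies in
`G_{PQ}`. In a tree, an element of `G_P` outside `G_{PQ}` pushes everything behind `Q` one step
further from `Q`, and symmetrically. Hence a reduced word of length `n` carries an end of `PQ` to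
distance `n` from one end and `n + 1` from the other (`exists_dist_of_reduced`), and a nonempty one
is never in `G_{PQ}`. With normal forms in the amalgam this gives injectivity; surjectivity holds
because `G_P` and `G_Q` generate `A^{PQ}`.

The map is continuous by the universal property of the finest group topology. Its inverse is
continuous because `G_{PQ}` is open, `k(Z)` being a finitely generated field, and on `G_{PQ}` the
inverse is the canonical map from `G_P`. -/

theorem IsBirationalOntoImage.mono_fromSpecStalk_comp {Z W : Scheme.{u}} [IsIntegral Z] {φ : Z ⟶ W}
    (h : IsBirationalOntoImage φ) : Mono (Z.fromSpecStalk (genericPoint Z) ≫ φ) := by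
  obtain ⟨e, he⟩ := h
  have hmem : genericPoint Z ∈ e.source :=
    ((genericPoint_spec Z).mem_open_set_iff e.source.isOpen).2
      (by simpa using e.dense_source.nonempty)
  -- The generic point lies in the dense open source, so the map factors through the isomorphism of
  -- opens followed by two immersions, all monomorphisms.
  have h1 : Z.fromSpecStalk (genericPoint Z) ≫ φ =
      e.source.fromSpecStalkOfMem (genericPoint Z) hmem ≫ e.iso.hom ≫ e.target.ι ≫ φ.imageι := by
    rw [reassoc_of% he, Scheme.Hom.toImage_imageι, Scheme.Opens.fromSpecStalkOfMem_ι_assoc]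
  have : Mono (e.source.fromSpecStalkOfMem (genericPoint Z) hmem) := by
    have h2 := e.source.fromSpecStalkOfMem_ι (genericPoint Z) hmem
    have : Mono (e.source.fromSpecStalkOfMem (genericPoint Z) hmem ≫ e.source.ι) := by
      rw [h2]; infer_instance
    exact mono_of_mono _ e.source.ι
  rw [h1]
  infer_instance

theorem specMap_functionFieldMap_fromSpecStalk {Z X : Scheme.{u}} [IsIntegral Z] [IsIntegral X]
    (f : Z ⟶ X) [IsDominant f] :
    Spec.map (functionFieldMap f) ≫ X.fromSpecStalk (genericPoint X) =
      Z.fromSpecStalk (genericPoint Z) ≫ f := by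
  rw [functionFieldMap, Spec.map_comp, Category.assoc,
    Scheme.SpecMap_stalkSpecializes_fromSpecStalk, Scheme.SpecMap_stalkMap_fromSpecStalk]

namespace Correspondence

variable {k : Type u} [Field k] {C : Correspondence k}

/-- `Spec k(Z) ⟶ X ×ₖ Y` is a monomorphism, and maps into the product are tested on the two
projections. The target is any ring because a tensor product is needed next. -/
theorem IsMinimal.ringHom_ext (hC : C.IsMinimal) {R : Type u} [CommRing R]
    (a b : C.Z.FunctionField →+* R)
    (hX : ∀ x, a (C.f.pullback x) = b (C.f.pullback x))
    (hY : ∀ y, a (C.g.pullback y) = b (C.g.pullback y)) : a = b := by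
  have := C.f.dominant
  have := C.g.dominant
  have hmono := IsBirationalOntoImage.mono_fromSpecStalk_comp hC
  let a' : C.Z.scheme.functionField ⟶ CommRingCat.of R := CommRingCat.ofHom a
  let b' : C.Z.scheme.functionField ⟶ CommRingCat.of R := CommRingCat.ofHom b
  have haX : functionFieldMap C.f.hom ≫ a' = functionFieldMap C.f.hom ≫ b' := by
    ext x; exact hX x
  have haY : functionFieldMap C.g.hom ≫ a' = functionFieldMap C.g.hom ≫ b' := by
    ext x; exact hY x
  have hab : Spec.map a' = Spec.map b' := by
    rw [← cancel_mono (C.Z.scheme.fromSpecStalk (genericPoint C.Z.scheme) ≫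
      pullback.lift (f := C.X.str) (g := C.Y.str) C.f.hom C.g.hom
        (C.f.comp_str.trans C.g.comp_str.symm))]
    apply pullback.hom_ext
    · simp only [Category.assoc, pullback.lift_fst]
      rw [← specMap_functionFieldMap_fromSpecStalk, ← Spec.map_comp_assoc, haX, Spec.map_comp_assoc]
    · simp only [Category.assoc, pullback.lift_snd]
      rw [← specMap_functionFieldMap_fromSpecStalk, ← Spec.map_comp_assoc, haY, Spec.map_comp_assoc]
  have hab' : a' = b' := Spec.map_injective hab
  exact congrArg CommRingCat.Hom.hom hab'

open scoped TensorProduct in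
-- Over the subfield `F` generated by both images, the two inclusions of `k(Z)` in `k(Z) ⊗[F] k(Z)`
-- agree on generators, hence everywhere; by faithfully flat descent they agree only on `F`.
theorem IsMinimal.adjoin_eq_top (hC : C.IsMinimal) :
    IntermediateField.adjoin k
      (Set.range C.f.pullback ∪ Set.range C.g.pullback : Set C.Z.FunctionField) = ⊤ := by
  set F := IntermediateField.adjoin k
      (Set.range C.f.pullback ∪ Set.range C.g.pullback : Set C.Z.FunctionField) with hF
  have hmem : ∀ x ∈ (Set.range C.f.pullback ∪ Set.range C.g.pullback : Set C.Z.FunctionField),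
      (Algebra.TensorProduct.includeLeft : C.Z.FunctionField →ₐ[F] _) x =
        (Algebra.TensorProduct.includeRight :
          C.Z.FunctionField →ₐ[F] C.Z.FunctionField ⊗[F] C.Z.FunctionField) x := by
    intro x hx
    have hxF : x ∈ F := IntermediateField.subset_adjoin _ _ hx
    exact ((Algebra.TensorProduct.includeLeft : C.Z.FunctionField →ₐ[F]
      C.Z.FunctionField ⊗[F] C.Z.FunctionField).commutes ⟨x, hxF⟩).trans
      (AlgHom.commutes _ _).symm
  have heq := hC.ringHom_ext
    (Algebra.TensorProduct.includeLeftRingHom :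
      C.Z.FunctionField →+* C.Z.FunctionField ⊗[F] C.Z.FunctionField)
    (Algebra.TensorProduct.includeRight :
      C.Z.FunctionField →ₐ[F] C.Z.FunctionField ⊗[F] C.Z.FunctionField).toRingHom
    (fun x => hmem _ (Or.inl ⟨x, rfl⟩)) (fun y => hmem _ (Or.inr ⟨y, rfl⟩))
  have heff := Algebra.IsEffective.eqLocus_includeLeft_includeRight
    (Algebra.IsEffective.of_faithfullyFlat F C.Z.FunctionField)
  refine top_le_iff.1 fun x _ => ?_
  have hx : x ∈ Set.range (algebraMap F C.Z.FunctionField) := by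
    rw [← heff]; exact DFunLike.congr_fun heq x
  obtain ⟨y, rfl⟩ := hx
  exact y.2

/-- Goes through generators because `Ω` may live in a different universe from the rings allowed in
`IsMinimal.ringHom_ext`. -/
theorem IsMinimal.algHom_ext (hC : C.IsMinimal) {Ω : Type v} [Field Ω]
    [Algebra k Ω] {a b : C.Z.FunctionField →ₐ[k] Ω}
    (hX : a.comp C.f.pullback = b.comp C.f.pullback)
    (hY : a.comp C.g.pullback = b.comp C.g.pullback) : a = b := by
  refine AlgHom.ext fun x => ?_
  have hx : x ∈ IntermediateField.adjoin k
      (Set.range C.f.pullback ∪ Set.range C.g.pullback : Set C.Z.FunctionField) := by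
    rw [hC.adjoin_eq_top]; trivial
  induction hx using IntermediateField.adjoin_induction with
  | mem x hx =>
    obtain ⟨y, rfl⟩ | ⟨y, rfl⟩ := hx
    · exact DFunLike.congr_fun hX y
    · exact DFunLike.congr_fun hY y
  | algebraMap x => simp
  | add x y _ _ hx hy => simp [hx, hy]
  | inv x _ hx => simp [hx]
  | mul x y _ _ hx hy => simp [hx, hy]

end Correspondence

theorem Curve.essFiniteType_functionField {k : Type u} [Field k] (C : Curve k) :
    Algebra.EssFiniteType k C.FunctionField := by
  have := C.smooth
  obtain ⟨_, ⟨U, hU, rfl⟩, hηU, -⟩ :=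
    C.scheme.isBasis_affineOpens.exists_subset_of_mem_open
      (Set.mem_univ (genericPoint C.scheme)) isOpen_univ
  have : Nonempty U := ⟨⟨_, hηU⟩⟩
  have := functionField_isFractionRing_of_isAffineOpen C.scheme U hU
  have hfr : Algebra.EssFiniteType Γ(C.scheme, U) C.scheme.functionField :=
    Algebra.EssFiniteType.of_isLocalization _ (nonZeroDivisors Γ(C.scheme, U))
  have h1 : (C.str.appLE ⊤ U le_top).hom.FiniteType :=
    C.str.finiteType_appLE (isAffineOpen_top _) hU le_top
  have h2 : (Scheme.ΓSpecIso (CommRingCat.of k)).inv.hom.FiniteType :=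
    RingHom.FiniteType.of_surjective _
      (Scheme.ΓSpecIso (CommRingCat.of k)).symm.commRingCatIsoToRingEquiv.surjective
  have h3 : C.constants = (Scheme.ΓSpecIso (CommRingCat.of k)).inv ≫ C.str.appLE ⊤ U le_top ≫
      C.scheme.germToFunctionField U := by
    simp only [Curve.constants, Scheme.germToFunctionField, Scheme.Hom.appLE, Category.assoc]
    erw [C.scheme.presheaf.germ_res]
    rfl
  have h4 : C.constants.hom.EssFiniteType := by
    rw [h3]
    exact (h2.essFiniteType.comp h1.essFiniteType).comp
      (RingHom.essFiniteType_algebraMap.2 hfr)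
  exact h4

/-! ### Distances in trees -/

namespace SimpleGraph

variable {V : Type*} {G : SimpleGraph V}

/-- Both neighbours are the first step of a geodesic from `p` to `x`, and paths in a tree are
unique. -/
theorem IsTree.eq_of_adj_of_dist_eq (hG : G.IsTree) {p q q' x : V} (hq : G.Adj p q)
    (hq' : G.Adj p q') (h : G.dist p x = G.dist q x + 1) (h' : G.dist p x = G.dist q' x + 1) :
    q = q' := by
  obtain ⟨w, hw⟩ := hG.connected.exists_walk_length_eq_dist q x
  obtain ⟨w', hw'⟩ := hG.connected.exists_walk_length_eq_dist q' x
  have hp : (Walk.cons hq w).IsPath := Walk.isPath_of_length_eq_dist _ (by simp [hw, h])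
  have hp' : (Walk.cons hq' w').IsPath := Walk.isPath_of_length_eq_dist _ (by simp [hw', h'])
  have := congrArg Subtype.val ((hG.isAcyclic.subsingleton_path p x).elim ⟨_, hp⟩ ⟨_, hp'⟩)
  simp only [Walk.cons.injEq] at this
  exact this.1

theorem Iso.dist_apply {W : Type*} {H : SimpleGraph W} (φ : G ≃g H) (u v : V) :
    H.dist (φ u) (φ v) = G.dist u v := by
  rw [dist_eq_sInf, dist_eq_sInf]
  congr 1
  ext n
  constructor
  · rintro ⟨w, rfl⟩
    exact ⟨(w.map φ.symm.toHom).copy (φ.symm_apply_apply u) (φ.symm_apply_apply v), by simp⟩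
  · rintro ⟨w, rfl⟩
    exact ⟨w.map φ.toHom, by simp⟩

theorem ConnectedComponent.dist_toSimpleGraph (C : G.ConnectedComponent) (u v : C) :
    C.toSimpleGraph.dist u v = G.dist u v := by
  classical
  rw [dist_eq_sInf, dist_eq_sInf]
  congr 1
  ext n
  constructor
  · rintro ⟨w, rfl⟩
    exact ⟨w.map C.toSimpleGraph_hom, Walk.length_map _ _⟩
  · rintro ⟨w, rfl⟩
    have hw : ∀ x ∈ w.support, x ∈ C.supp := fun x hx =>
      (ConnectedComponent.sound (w.takeUntil x hx).reachable.symm).trans u.2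
    exact ⟨w.induce C.supp hw, (Walk.length_map (Embedding.induce C.supp).toHom
      (w.induce C.supp hw)).symm.trans (congrArg Walk.length (Walk.map_induce w hw))⟩

/-- An automorphism that fixes a vertex `p` of a tree component and moves its neighbour `q` moves
the vertices behind `q` one step further away from `p`. -/
theorem ConnectedComponent.dist_apply_of_apply_ne {C : G.ConnectedComponent}
    (hC : C.toSimpleGraph.IsTree) {p q x : V} (hp : p ∈ C) (hx : x ∈ C) (hpq : G.Adj p q)
    (φ : G ≃g G) (hφp : φ p = p) (hφq : φ q ≠ q) {n : ℕ} (hq : G.dist q x = n)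
    (hn : G.dist p x = n + 1) :
    φ x ∈ C ∧ G.dist p (φ x) = n + 1 ∧ G.dist q (φ x) = n + 2 := by
  have hrange : ∀ {y z}, y ∈ C → G.Reachable y z → z ∈ C := fun hy h =>
    (ConnectedComponent.sound h.symm).trans hy
  have hpφx : G.dist p (φ x) = n + 1 := by rw [← hn, ← φ.dist_apply p x, hφp]
  have hadj : G.Adj p (φ.symm q) := by
    rw [← φ.map_adj_iff, hφp, φ.apply_symm_apply]; exact hpq
  have hqC := hrange hp hpq.reachable
  have hqC' := hrange hp hadj.reachable
  have hdist : G.dist q (φ x) = G.dist (φ.symm q) x := by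
    rw [← φ.dist_apply (φ.symm q) x, φ.apply_symm_apply]
  -- Unreachable vertices have distance `0` by convention, so the distance `n + 1` forces `φ x` into
  -- the component of `p`.
  have hφx : φ x ∈ C := hrange hp (Reachable.of_dist_ne_zero (by omega))
  refine ⟨hφx, hpφx, ?_⟩
  rw [hdist]
  -- The neighbour `φ⁻¹ q` of `p` is either nearer to `x` than `p`, hence equal to `q`, which is
  -- excluded, or further away, at distance `n + 2`.
  have key := hC.dist_eq_dist_add_one_of_adj ⟨x, hx⟩ (v := ⟨p, hp⟩) (w := ⟨φ.symm q, hqC'⟩)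
    (by simpa [ConnectedComponent.toSimpleGraph] using hadj)
  rw [C.dist_toSimpleGraph, C.dist_toSimpleGraph] at key
  change G.dist x p = G.dist x (φ.symm q) + 1 ∨ G.dist x (φ.symm q) = G.dist x p + 1 at key
  rw [dist_comm (v := p), dist_comm (v := φ.symm q)] at key
  obtain key | key := key
  · refine absurd ?_ hφq
    have := hC.eq_of_adj_of_dist_eq (p := ⟨p, hp⟩) (q := ⟨q, hqC⟩) (q' := ⟨φ.symm q, hqC'⟩)
      (x := ⟨x, hx⟩) (by simpa [ConnectedComponent.toSimpleGraph] using hpq)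
      (by simpa [ConnectedComponent.toSimpleGraph] using hadj)
      (by
        rw [C.dist_toSimpleGraph, C.dist_toSimpleGraph]
        change G.dist p x = G.dist q x + 1
        omega)
      (by
        rw [C.dist_toSimpleGraph, C.dist_toSimpleGraph]
        change G.dist p x = G.dist (φ.symm q) x + 1
        omega)
    rw [Subtype.mk.injEq] at this
    conv_lhs => rw [this, φ.apply_symm_apply]
  · omega

end SimpleGraph

/-! ### The action of automorphisms on the generic graph -/

/-- Uniqueness of the algebraic closure, applied to `Ω` over `E` along `g`. -/
theorem FieldAut.exists_algEquiv_extension {k : Type u} {Ω : Type v} [Field k] [Field Ω]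
    [Algebra k Ω] [IsAlgClosed Ω] {E : IntermediateField k Ω} [Algebra.IsAlgebraic E Ω]
    (g : FieldAut k E) : ∃ σ : Ω ≃ₐ[k] Ω, ∀ x : E, σ x = g x := by
  have : IsAlgClosure E Ω := ⟨inferInstance, inferInstance⟩
  let g' : E ≃ₐ[k] E := g
  have h := IsAlgClosure.equivOfEquiv_algebraMap (R := E) (S := E) Ω Ω g'.toRingEquiv
  refine ⟨AlgEquiv.ofRingEquiv (f := IsAlgClosure.equivOfEquiv Ω Ω g'.toRingEquiv) fun r => ?_, h⟩
  rw [IsScalarTower.algebraMap_apply k E Ω, h]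
  exact congrArg _ (g'.commutes r)

section GenericGraph

variable {k : Type u} {L K M : Type u} {Ω : Type v} [Field k] [Field L] [Field K] [Field M]
  [Field Ω] [Algebra k L] [Algebra k K] [Algebra k M] [Algebra k Ω]

/-- The automorphism of the full generic graph induced by an automorphism of `Ω`. -/
noncomputable def fullGenericGraphAut (i : L →ₐ[k] M) (j : K →ₐ[k] M) (σ : Ω ≃ₐ[k] Ω) :
    fullGenericGraph Ω i j ≃g fullGenericGraph Ω i j where
  toEquiv := Equiv.sumCongr (AlgEquiv.refl.arrowCongr σ) (AlgEquiv.refl.arrowCongr σ)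
  map_rel_iff' {a b} := by
    have key (p : L →ₐ[k] Ω) (q : K →ₐ[k] Ω) :
        (∃ e : M →ₐ[k] Ω, e.comp i = AlgEquiv.refl.arrowCongr σ p ∧
          e.comp j = AlgEquiv.refl.arrowCongr σ q) ↔
        ∃ e : M →ₐ[k] Ω, e.comp i = p ∧ e.comp j = q := by
      constructor
      · rintro ⟨e, hp, hq⟩
        refine ⟨(σ.symm : Ω →ₐ[k] Ω).comp e, ?_, ?_⟩
        · ext x
          simpa using congrArg σ.symm (DFunLike.congr_fun hp x)
        · ext x
          simpa using congrArg σ.symm (DFunLike.congr_fun hq x)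
      · rintro ⟨e, rfl, rfl⟩
        exact ⟨(σ : Ω →ₐ[k] Ω).comp e, by ext; simp, by ext; simp⟩
    rcases a with p | q <;> rcases b with p' | q'
    · exact Iff.rfl
    · exact key p q'
    · exact key p' q
    · exact Iff.rfl

variable (i : L →ₐ[k] M) (j : K →ₐ[k] M) (PQ : M →ₐ[k] Ω)

/-- The two ends `P` (for `false`) and `Q` (for `true`) of the edge `PQ`. -/
def edgeEnd : Bool → (L →ₐ[k] Ω) ⊕ (K →ₐ[k] Ω)
  | false => .inl (PQ.comp i)
  | true => .inr (PQ.comp j)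

theorem adj_edgeEnd (b : Bool) :
    (fullGenericGraph Ω i j).Adj (edgeEnd i j PQ b) (edgeEnd i j PQ !b) := by
  cases b <;> exact ⟨PQ, rfl, rfl⟩

theorem edgeEnd_mem_genericComponent (b : Bool) : edgeEnd i j PQ b ∈ genericComponent i j PQ := by
  cases b
  · exact rfl
  · exact SimpleGraph.ConnectedComponent.sound (adj_edgeEnd i j PQ true).reachable

theorem fieldRange_le_fieldInfty : PQ.fieldRange ≤ fieldInfty i j PQ :=
  le_iSup (galoisTower i j PQ) 0

variable {i j PQ}

theorem fullGenericGraphAut_edgeEnd_of_mem {b : Bool} {g : FieldAut k (fieldInfty i j PQ)}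
    (hg : g ∈ vertexGroup i j PQ b) {σ : Ω ≃ₐ[k] Ω} (hσ : ∀ x : fieldInfty i j PQ, σ x = g x) :
    fullGenericGraphAut i j σ (edgeEnd i j PQ b) = edgeEnd i j PQ b := by
  have hle := fieldRange_le_fieldInfty i j PQ
  cases b
  · refine congrArg Sum.inl (AlgHom.ext fun x => ?_)
    have hx := hg ⟨PQ (i x), hle ⟨_, rfl⟩⟩ ⟨x, rfl⟩
    exact (hσ ⟨PQ (i x), hle ⟨_, rfl⟩⟩).trans (congrArg Subtype.val hx)
  · refine congrArg Sum.inr (AlgHom.ext fun x => ?_)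
    have hx := hg ⟨PQ (j x), hle ⟨_, rfl⟩⟩ ⟨x, rfl⟩
    exact (hσ ⟨PQ (j x), hle ⟨_, rfl⟩⟩).trans (congrArg Subtype.val hx)

theorem mem_edgeGroup_of_fullGenericGraphAut_edgeEnd
    (hmin : ∀ a b : M →ₐ[k] Ω, a.comp i = b.comp i → a.comp j = b.comp j → a = b)
    {g : FieldAut k (fieldInfty i j PQ)} {σ : Ω ≃ₐ[k] Ω}
    (hσ : ∀ x : fieldInfty i j PQ, σ x = g x)
    (h : ∀ b, fullGenericGraphAut i j σ (edgeEnd i j PQ b) = edgeEnd i j PQ b) :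
    g ∈ edgeGroup i j PQ := by
  have heq : (σ : Ω →ₐ[k] Ω).comp PQ = PQ :=
    hmin _ _ (Sum.inl_injective (h false)) (Sum.inr_injective (h true))
  rintro ⟨_, hx⟩ ⟨x, rfl⟩
  exact Subtype.ext ((hσ _).symm.trans (DFunLike.congr_fun heq x))

/-- A reduced word in `G_P` and `G_Q` moves one of the ends of the edge `PQ` as far away as its
length. -/
theorem exists_dist_of_reduced [IsAlgClosed Ω] [Algebra.IsAlgebraic (fieldInfty i j PQ) Ω]
    (hmin : ∀ a b : M →ₐ[k] Ω, a.comp i = b.comp i → a.comp j = b.comp j → a = b)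
    (hT : (genericGraph i j PQ).IsTree) (l : List (Σ b, vertexGroup i j PQ b))
    (hl : ∀ s ∈ l, (s.2 : FieldAut k (fieldInfty i j PQ)) ∉ edgeGroup i j PQ)
    (hc : l.IsChain fun s t => s.1 ≠ t.1) (b : Bool) (hb : ∀ s ∈ l.head?, s.1 ≠ b) :
    ∃ (σ : Ω ≃ₐ[k] Ω) (c : Bool),
      (∀ x : fieldInfty i j PQ,
        σ x = (l.map fun s => (s.2 : FieldAut k (fieldInfty i j PQ))).prod x) ∧
      fullGenericGraphAut i j σ (edgeEnd i j PQ c) ∈ genericComponent i j PQ ∧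
      (fullGenericGraph Ω i j).dist (edgeEnd i j PQ !b)
        (fullGenericGraphAut i j σ (edgeEnd i j PQ c)) = l.length ∧
      (fullGenericGraph Ω i j).dist (edgeEnd i j PQ b)
        (fullGenericGraphAut i j σ (edgeEnd i j PQ c)) = l.length + 1 := by
  induction l generalizing b with
  | nil =>
    have h1 : fullGenericGraphAut i j AlgEquiv.refl (edgeEnd i j PQ !b) = edgeEnd i j PQ !b := by
      cases b <;> rfl
    refine ⟨AlgEquiv.refl, !b, fun x => rfl, ?_⟩
    rw [h1]
    exact ⟨edgeEnd_mem_genericComponent i j PQ _, SimpleGraph.dist_self,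
      SimpleGraph.dist_eq_one_iff_adj.2 (adj_edgeEnd i j PQ b)⟩
  | cons s l ih =>
    obtain ⟨b', g⟩ := s
    obtain rfl : b = !b' := by
      have : b' ≠ b := hb ⟨b', g⟩ (by simp)
      revert this; cases b <;> cases b' <;> simp
    rw [List.isChain_cons] at hc
    -- The tail does not begin in colour `b'`, so its image lies behind the end `!b'` as seen from
    -- the end `b'`, which `g` fixes.
    obtain ⟨σ, c, hσ, hmem, hd, hd'⟩ := ih (fun s hs => hl s (List.mem_cons_of_mem _ hs)) hc.2 b'
      (fun s hs => (hc.1 s hs).symm)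
    obtain ⟨τ, hτ⟩ := FieldAut.exists_algEquiv_extension (g : FieldAut k (fieldInfty i j PQ))
    have hfix := fullGenericGraphAut_edgeEnd_of_mem g.2 hτ
    have hmove : fullGenericGraphAut i j τ (edgeEnd i j PQ !b') ≠ edgeEnd i j PQ !b' := by
      refine fun h => hl ⟨b', g⟩ List.mem_cons_self
        (mem_edgeGroup_of_fullGenericGraphAut_edgeEnd hmin hτ fun b => ?_)
      obtain rfl | rfl : b = b' ∨ b = !b' := by cases b <;> cases b' <;> simp
      · exact hfix
      · exact h
    have hcomp : fullGenericGraphAut i j (σ.trans τ) (edgeEnd i j PQ c) =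
        fullGenericGraphAut i j τ (fullGenericGraphAut i j σ (edgeEnd i j PQ c)) := by
      cases c <;> rfl
    obtain ⟨h1, h2, h3⟩ := SimpleGraph.ConnectedComponent.dist_apply_of_apply_ne hT
      (edgeEnd_mem_genericComponent i j PQ b') hmem (adj_edgeEnd i j PQ b') _ hfix hmove hd hd'
    refine ⟨σ.trans τ, c, fun x => ?_, ?_⟩
    · rw [AlgEquiv.trans_apply, hσ, hτ, List.map_cons, List.prod_cons, FieldAut.mul_apply]
    · rw [hcomp, Bool.not_not]
      exact ⟨h1, h2, h3⟩

/-! ### The comparison of the amalgamated product with `A^{PQ}` -/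

theorem eq_nil_of_reduced_of_prod_mem_edgeGroup [IsAlgClosed Ω]
    [Algebra.IsAlgebraic (fieldInfty i j PQ) Ω]
    (hmin : ∀ a b : M →ₐ[k] Ω, a.comp i = b.comp i → a.comp j = b.comp j → a = b)
    (hT : (genericGraph i j PQ).IsTree) (l : List (Σ b, vertexGroup i j PQ b))
    (hl : ∀ s ∈ l, (s.2 : FieldAut k (fieldInfty i j PQ)) ∉ edgeGroup i j PQ)
    (hc : l.IsChain fun s t => s.1 ≠ t.1)
    (h : (l.map fun s => (s.2 : FieldAut k (fieldInfty i j PQ))).prod ∈ edgeGroup i j PQ) :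
    l = [] := by
  obtain ⟨b, hb⟩ : ∃ b, ∀ s ∈ l.head?, s.1 ≠ b := by
    cases l with
    | nil => exact ⟨false, by simp⟩
    | cons s l => exact ⟨!s.1, by simp⟩
  obtain ⟨σ, c, hσ, -, hd, hd'⟩ := exists_dist_of_reduced hmin hT l hl hc b hb
  rw [fullGenericGraphAut_edgeEnd_of_mem (edgeGroup_le i j PQ c h) hσ] at hd hd'
  rw [← List.length_eq_zero_iff]
  -- The image is the end `c` itself, so one of the two distances vanishes; it can only be the one
  -- equal to the length.
  obtain rfl | rfl : c = b ∨ c = !b := by cases b <;> cases c <;> simp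
  · rw [SimpleGraph.dist_self] at hd'
    omega
  · rw [SimpleGraph.dist_self] at hd
    exact hd.symm

namespace Amalgam

theorem toGroupAPQ_of (b : Bool) (g : vertexGroup i j PQ b) :
    toGroupAPQ i j PQ (of i j PQ b g) = Subgroup.inclusion (vertexGroup_le i j PQ b) g :=
  Monoid.PushoutI.lift_of (φ := fun b : Bool => Subgroup.inclusion (edgeGroup_le i j PQ b))
    (fun b => Subgroup.inclusion (vertexGroup_le i j PQ b))
    (Subgroup.inclusion ((edgeGroup_le i j PQ false).trans (vertexGroup_le i j PQ false)))
    (fun _ => rfl) g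

theorem of_inclusion (b : Bool) (h : edgeGroup i j PQ) :
    of i j PQ b (Subgroup.inclusion (edgeGroup_le i j PQ b) h) =
      Monoid.PushoutI.base (fun b : Bool => Subgroup.inclusion (edgeGroup_le i j PQ b)) h :=
  Monoid.PushoutI.of_apply_eq_base
    (fun b : Bool => Subgroup.inclusion (edgeGroup_le i j PQ b)) b h

/-- The product in `G_P *_{G_{PQ}} G_Q` of a list of elements of `G_P` and `G_Q`. -/
noncomputable def listProd (l : List (Σ b, vertexGroup i j PQ b)) : Amalgam i j PQ :=
  (l.map fun s => of i j PQ s.1 s.2).prod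

theorem coe_toGroupAPQ_listProd (l : List (Σ b, vertexGroup i j PQ b)) :
    (toGroupAPQ i j PQ (listProd l) : FieldAut k (fieldInfty i j PQ)) =
      (l.map fun s => (s.2 : FieldAut k (fieldInfty i j PQ))).prod := by
  rw [listProd, map_list_prod, Subgroup.val_list_prod, List.map_map, List.map_map]
  congr 2

/-- The normal form of an element of `G_P *_{G_{PQ}} G_Q`. -/
theorem exists_eq_of_mul_listProd (x : Amalgam i j PQ) :
    ∃ (h : edgeGroup i j PQ) (l : List (Σ b, vertexGroup i j PQ b)),
      (∀ s ∈ l, (s.2 : FieldAut k (fieldInfty i j PQ)) ∉ edgeGroup i j PQ) ∧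
      (l.IsChain fun s t => s.1 ≠ t.1) ∧
      x = of i j PQ false (Subgroup.inclusion (edgeGroup_le i j PQ false) h) * listProd l := by
  classical
  obtain ⟨d⟩ := Monoid.PushoutI.NormalWord.transversal_nonempty
    (fun b : Bool => Subgroup.inclusion (edgeGroup_le i j PQ b))
    (fun b => Subgroup.inclusion_injective _)
  obtain ⟨w, rfl⟩ := (Monoid.PushoutI.NormalWord.equiv (d := d)).symm.surjective x
  refine ⟨w.head, w.toList, fun s hs hmem => ?_, w.chain_ne, ?_⟩
  · have := (d.compl s.1).1
      (a₁ := (⟨⟨s.2, ⟨⟨s.2, hmem⟩, rfl⟩⟩, ⟨1, d.one_mem _⟩⟩ : (Subgroup.inclusion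
        (edgeGroup_le i j PQ s.1)).range × d.set s.1))
      (a₂ := ⟨1, ⟨s.2, w.normalized _ _ hs⟩⟩) (by simp)
    exact w.ne_one s hs (congrArg (fun a => (a.1 : vertexGroup i j PQ s.1)) this)
  · rw [of_inclusion]
    refine congrArg (Monoid.PushoutI.base _ w.head * ·) ?_
    rw [Monoid.CoprodI.Word.prod, map_list_prod, List.map_map]
    rfl

theorem toGroupAPQ_surjective : Function.Surjective (toGroupAPQ i j PQ) := by
  have h : groupAPQ i j PQ ≤ ((groupAPQ i j PQ).subtype.comp (toGroupAPQ i j PQ)).range :=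
    sup_le (fun g hg => ⟨of i j PQ false ⟨g, hg⟩, congrArg Subtype.val (toGroupAPQ_of false ⟨g, hg⟩)⟩)
      (fun g hg => ⟨of i j PQ true ⟨g, hg⟩, congrArg Subtype.val (toGroupAPQ_of true ⟨g, hg⟩)⟩)
  rintro ⟨g, hg⟩
  obtain ⟨x, hx⟩ := h hg
  exact ⟨x, Subtype.ext hx⟩

theorem toGroupAPQ_injective [IsAlgClosed Ω] [Algebra.IsAlgebraic (fieldInfty i j PQ) Ω]
    (hmin : ∀ a b : M →ₐ[k] Ω, a.comp i = b.comp i → a.comp j = b.comp j → a = b)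
    (hT : (genericGraph i j PQ).IsTree) : Function.Injective (toGroupAPQ i j PQ) := by
  rw [injective_iff_map_eq_one]
  intro x hx
  obtain ⟨h, l, hl, hc, rfl⟩ := exists_eq_of_mul_listProd x
  have hx' := congrArg Subtype.val hx
  rw [map_mul, toGroupAPQ_of, Subgroup.coe_mul, coe_toGroupAPQ_listProd, Subgroup.coe_one] at hx'
  have hnil : l = [] := by
    refine eq_nil_of_reduced_of_prod_mem_edgeGroup hmin hT l hl hc ?_
    rw [eq_inv_of_mul_eq_one_right hx']
    exact inv_mem h.2
  subst hnil
  rw [List.map_nil, List.prod_nil, mul_one] at hx'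
  have hh : h = 1 := Subtype.ext hx'
  rw [hh, map_one, map_one, one_mul]
  rfl

/-! ### Continuity in both directions -/

theorem continuous_of (b : Bool) : Continuous (of i j PQ b) := by
  change @Continuous _ _ _ (sInf (GroupTopology.toTopologicalSpace '' _)) _
  rw [continuous_sInf_rng]
  rintro _ ⟨t, ht, rfl⟩
  exact ht b

/-- The topology pulled back from `A^{PQ}` is a group topology making both canonical maps
continuous, so the finest such topology refines it. -/
theorem continuous_toGroupAPQ : Continuous (toGroupAPQ i j PQ) := by
  rw [continuous_iff_le_induced]
  let t : GroupTopology (Amalgam i j PQ) :=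
    ⟨TopologicalSpace.induced (toGroupAPQ i j PQ) inferInstance,
      topologicalGroup_induced (toGroupAPQ i j PQ)⟩
  have ht : groupTopology i j PQ ≤ t := by
    refine sInf_le fun b => continuous_induced_rng.2 (continuous_induced_rng.2 ?_)
    refine (continuous_subtype_val (p := (· ∈ vertexGroup i j PQ b))).congr fun g => ?_
    exact (congrArg Subtype.val (toGroupAPQ_of b g)).symm
  exact ht

end Amalgam

/-- An embedding of `k(Z)` is determined on finitely many generators, so finitely many conditions `g
x = x` cut out `G_{PQ}`. -/
theorem isOpen_edgeGroup [Algebra.EssFiniteType k M] :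
    IsOpen (edgeGroup i j PQ : Set (FieldAut k (fieldInfty i j PQ))) := by
  have hle := fieldRange_le_fieldInfty i j PQ
  have h : (edgeGroup i j PQ : Set (FieldAut k (fieldInfty i j PQ))) =
      ⋂ s ∈ Algebra.EssFiniteType.finset k M,
        {g | g ⟨PQ s, hle ⟨s, rfl⟩⟩ = ⟨PQ s, hle ⟨s, rfl⟩⟩} := by
    ext g
    simp only [SetLike.mem_coe, Set.mem_iInter, Set.mem_ofPred_eq]
    refine ⟨fun hg s _ => hg _ ⟨s, rfl⟩, fun hg => ?_⟩
    let e : M →ₐ[k] fieldInfty i j PQ :=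
      PQ.codRestrict (fieldInfty i j PQ).toSubalgebra fun x => hle ⟨x, rfl⟩
    let g' : fieldInfty i j PQ →ₐ[k] fieldInfty i j PQ := AlgHomClass.toAlgHom g
    have heq : g'.comp e = e := Algebra.EssFiniteType.algHom_ext _ _ _ hg
    rintro ⟨_, hx⟩ ⟨x, rfl⟩
    exact DFunLike.congr_fun heq x
  rw [h]
  exact isOpen_biInter_finset fun s _ => FieldAut.isOpen_setOf_apply_eq _ _

namespace Amalgam

theorem exists_continuousMulEquiv [Algebra.EssFiniteType k M] [IsAlgClosed Ω]
    [Algebra.IsAlgebraic (fieldInfty i j PQ) Ω]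
    (hmin : ∀ a b : M →ₐ[k] Ω, a.comp i = b.comp i → a.comp j = b.comp j → a = b)
    (hT : (genericGraph i j PQ).IsTree) :
    ∃ e : Amalgam i j PQ ≃ₜ* groupAPQ i j PQ, ∀ x, e x = toGroupAPQ i j PQ x := by
  let e : Amalgam i j PQ ≃* groupAPQ i j PQ :=
    MulEquiv.ofBijective (toGroupAPQ i j PQ)
      ⟨toGroupAPQ_injective hmin hT, toGroupAPQ_surjective⟩
  have hsymm : Continuous e.symm := by
    -- For a homomorphism continuity at `1` suffices, so it can be checked on the open subgroup
    -- `G_{PQ}`, where the inverse factors through `G_P`.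
    refine continuous_of_continuousAt_one e.symm.toMonoidHom ?_
    let S : Set (groupAPQ i j PQ) := {a | (a : FieldAut k (fieldInfty i j PQ)) ∈ edgeGroup i j PQ}
    have hS : IsOpen S := isOpen_edgeGroup.preimage continuous_subtype_val
    refine ContinuousOn.continuousAt (s := S) ?_ (hS.mem_nhds (one_mem (edgeGroup i j PQ)))
    rw [continuousOn_iff_continuous_domRestrict]
    let r : S → vertexGroup i j PQ false := fun a => ⟨a.1.1, edgeGroup_le i j PQ false a.2⟩
    have hr : Continuous r :=
      (continuous_subtype_val.comp continuous_subtype_val).subtype_mk _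
    refine ((continuous_of false).comp hr).congr fun a => ?_
    refine (e.symm_apply_eq.2 (Subtype.ext ?_)).symm
    exact congrArg Subtype.val (toGroupAPQ_of false (r a)).symm
  exact ⟨{ e with
    continuous_toFun := continuous_toGroupAPQ
    continuous_invFun := hsymm }, fun _ => rfl⟩

end Amalgam

end GenericGraph

theorem proposition5p10 {k : Type u} [Field k] (C : Correspondence k) (hC : C.IsMinimal)
    {Ω : Type v} [Field Ω] [Algebra k Ω] [IsAlgClosed Ω]
    (PQ : C.Z.FunctionField →ₐ[k] Ω) (hPQ : Algebra.IsAlgebraic PQ.fieldRange Ω)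
    (hT : (genericGraph C.f.pullback C.g.pullback PQ).IsTree) :
    ∃ e : Amalgam C.f.pullback C.g.pullback PQ ≃ₜ* groupAPQ C.f.pullback C.g.pullback PQ,
      ∀ x, e x = Amalgam.toGroupAPQ C.f.pullback C.g.pullback PQ x := by
  have := C.Z.essFiniteType_functionField
  have hle := fieldRange_le_fieldInfty C.f.pullback C.g.pullback PQ
  have : Algebra.IsAlgebraic (fieldInfty C.f.pullback C.g.pullback PQ) Ω := by
    let := (IntermediateField.inclusion hle).toAlgebra
    have : IsScalarTower PQ.fieldRange (fieldInfty C.f.pullback C.g.pullback PQ) Ω :=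
      .of_algebraMap_eq fun _ => rfl
    exact Algebra.IsAlgebraic.tower_top (K := PQ.fieldRange) _
  exact Amalgam.exists_continuousMulEquiv (fun _ _ hX hY => hC.algHom_ext hX hY) hT
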